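/- There exist absolute constants $C, C'>0$ such that the following holds. Let $p\ge 2$, $k\in\{1,\dots,p\}$, $c_0>0$ and $\delta_0\in(0,1)$, and let $X\in\mathbb{R}^{n\times p}$ be a random matrix with i.i.d. $\mathcal N(0,1)$ entries and columns $X_1,\dots,X_p$. Define \[ \theta(k,c_0):=\min\Big\{\frac{\|X\delta\|_2}{\sqrt n\,\|\delta\|_2} : \delta\in\mathbb{R}^p\setminus\{0\},\ \|\delta\|_1\le (1+c_0)\sqrt k\,\|\delta\|_2\Big\}. \] If \[ n\ \ge\ C\,\delta_0^{-2}(2+c_0)^2\,k\log p, \] then with probability at least $1-2\exp(-C'k\log p)$, \[ \max_{1\le j\le p}\|X_j\|_2\le (1+\delta_0)\sqrt n\qquad\text{and}\qquad \theta(k,c_0)\ge 1-\delta_0 . \] -/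

import Mathlib

open MeasureTheory ProbabilityTheory
open scoped Matrix

/-- The Euclidean norm of the `j`-th column of `X`. -/
noncomputable def columnNorm {n p : ℕ} (X : Matrix (Fin n) (Fin p) ℝ) (j : Fin p) : ℝ :=
  ‖WithLp.toLp 2 (fun i => X i j)‖

/-- The cone of vectors `δ ∈ ℝ^p` with `‖δ‖₁ ≤ (1 + c₀) √k ‖δ‖₂`. -/
def sreCone (p k : ℕ) (c₀ : ℝ) : Set (EuclideanSpace ℝ (Fin p)) :=
  {δ | ∑ j, |δ j| ≤ (1 + c₀) * √(k : ℝ) * ‖δ‖}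

/-- The strong restricted eigenvalue constant `θ(k, c₀)` of `X`: the minimum of
`‖X δ‖₂ / (√n ‖δ‖₂)` over the nonzero vectors `δ` of the cone. The ratio is nonnegative,
and by homogeneity the minimum is over a compact set, so it is the infimum of the ratios
(for `p, k ≥ 1` and `c₀ ≥ 0` the cone has nonzero vectors, so this infimum is not vacuous). -/
noncomputable def sreConst {n p : ℕ} (X : Matrix (Fin n) (Fin p) ℝ) (k : ℕ) (c₀ : ℝ) : ℝ :=
  sInf ((fun δ : EuclideanSpace ℝ (Fin p) =>
    ‖WithLp.toLp 2 (X *ᵥ δ.ofLp)‖ / (√(n : ℝ) * ‖δ‖)) '' (sreCone p k c₀ \ {0}))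

/-- The random matrix `X` has independent standard Gaussian entries. -/
structure HasIIDStdGaussianEntries {Ω : Type*} [MeasurableSpace Ω] {n p : ℕ}
    (X : Ω → Matrix (Fin n) (Fin p) ℝ) (μ : Measure Ω) : Prop where
  hasLaw : ∀ i j, HasLaw (fun ω => X ω i j) (gaussianReal 0 1) μ
  indep : iIndepFun (fun (ij : Fin n × Fin p) ω => X ω ij.1 ij.2) μ

/-! Put `m = ⌈(1 + c₀)² k⌉`. For a fixed vector `w`, `‖Xw‖²` is `‖w‖²` times a chi-square variable
with `n` degrees of freedom, so it lies within `ε n ‖w‖²` of `n ‖w‖²` outside an event of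
probability `2 exp(-ε² n / 8)`. A union bound, with `ε = δ₀ / 5`, covers all integer vectors of `ℓ¹`
norm at most `4m`, of which there are at most `(2p+1)^(4m)`.

The rest is deterministic. A cone vector scaled to squared norm `m` has `ℓ¹` norm at most `m`, hence
is a convex combination of integer vectors with `ℓ¹` norm at most `2m` and squared norm at most `5m`
(`mem_convexHull_roundingSet`). Polarization bounds the form `XᵀX - n I` on pairs of these, since
their sums and differences are among the controlled vectors, and convexity in each argument extends
the bound to the cone (`abs_bilin_le_of_int`). The column bound is the case `w = e_j`. -/

/-! ### Counting integer vectors -/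

open scoped Pointwise in
/-- Integer vectors of `ℓ¹` norm at most `M` lie in a finite set of size at most `(2p+1)^M`. -/
lemma exists_finset_int_l1_le (p M : ℕ) :
    ∃ W : Finset (Fin p → ℤ), W.card ≤ (2 * p + 1) ^ M ∧
      ∀ w : Fin p → ℤ, ∑ j, |w j| ≤ M → w ∈ W := by
  classical
  -- A vector of `ℓ¹` norm at most `M` is a sum of `M` signed basis vectors, padded with zeros.
  let U : Finset (Fin p → ℤ) := insert 0
    ((Finset.univ.image fun j => Pi.single j 1) ∪ (Finset.univ.image fun j => Pi.single j (-1)))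
  have hU : U.card ≤ 2 * p + 1 := by
    refine (Finset.card_insert_le _ _).trans (Nat.succ_le_succ ?_)
    refine (Finset.card_union_le _ _).trans ?_
    have h1 := Finset.card_image_le (s := (Finset.univ : Finset (Fin p)))
      (f := fun j => (Pi.single j 1 : Fin p → ℤ))
    have h2 := Finset.card_image_le (s := (Finset.univ : Finset (Fin p)))
      (f := fun j => (Pi.single j (-1) : Fin p → ℤ))
    simp only [Finset.card_univ, Fintype.card_fin] at h1 h2
    omega
  refine ⟨M • U, Finset.card_nsmul_le.trans (Nat.pow_le_pow_left hU M), ?_⟩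
  induction M with
  | zero =>
    intro w hw
    have h0 : ∑ j, |w j| = 0 :=
      le_antisymm (by simpa using hw) (Finset.sum_nonneg fun j _ => abs_nonneg _)
    rw [Finset.sum_eq_zero_iff_of_nonneg fun j _ => abs_nonneg _] at h0
    have : w = 0 := funext fun j => by simpa using h0 j (Finset.mem_univ j)
    simp [this]
  | succ M ih =>
    intro w hw
    rw [succ_nsmul]
    by_cases h0 : w = 0
    · subst h0
      exact Finset.mem_add.2 ⟨0, ih 0 (by simp), 0, by simp [U], by simp⟩
    obtain ⟨j, hj⟩ := Function.ne_iff.1 h0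
    have key : ∀ s : ℤ, |w j - s| + 1 = |w j| → w - Pi.single j s ∈ M • U := by
      intro s hs
      apply ih
      have e1 := Finset.add_sum_erase Finset.univ (fun i => |w i|) (Finset.mem_univ j)
      have e2 := Finset.add_sum_erase Finset.univ
        (fun i => |(w - Pi.single j s : Fin p → ℤ) i|) (Finset.mem_univ j)
      have e3 : ∑ i ∈ Finset.univ.erase j, |(w - Pi.single j s : Fin p → ℤ) i|
          = ∑ i ∈ Finset.univ.erase j, |w i| :=
        Finset.sum_congr rfl fun i hi => by simp [Finset.ne_of_mem_erase hi]
      simp only [Pi.sub_apply, Pi.single_eq_same] at e1 e2 e3 ⊢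
      push_cast at hw
      linarith
    rcases lt_or_gt_of_ne hj with h | h
    · refine Finset.mem_add.2 ⟨_, key (-1) ?_, Pi.single j (-1), by simp [U], by simp⟩
      simp only [Pi.zero_apply] at h
      rw [abs_of_neg h, abs_of_nonpos (by omega)]; ring
    · refine Finset.mem_add.2 ⟨_, key 1 ?_, Pi.single j 1, by simp [U], by simp⟩
      simp only [Pi.zero_apply] at h
      rw [abs_of_pos h, abs_of_nonneg (by omega)]; ring

/-! ### Rounding to integer vectors by convex combinations -/

/-- Shifting mass between two fractional coordinates until one of them becomes integral. -/
lemma exists_shift_card_fractional_lt {p : ℕ} {f : Fin p → ℝ} (hf : ∀ j, f j ∈ Set.Icc (0 : ℝ) 1)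
    {i j : Fin p} (hij : i ≠ j) (hi : f i ∈ Set.Ioo (0 : ℝ) 1) (hj : f j ∈ Set.Ioo (0 : ℝ) 1) :
    ∃ a : ℝ, 0 < a ∧ ∃ g : Fin p → ℝ, g = f + a • (Pi.single i 1 - Pi.single j 1) ∧
      (∀ l, g l ∈ Set.Icc (0 : ℝ) 1) ∧ ∑ l, g l = ∑ l, f l ∧
      {l | g l ∈ Set.Ioo (0 : ℝ) 1}.ncard < {l | f l ∈ Set.Ioo (0 : ℝ) 1}.ncard := by
  obtain ⟨hi0, hi1⟩ := hi
  obtain ⟨hj0, hj1⟩ := hj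
  -- The first time at which coordinate `j` reaches `0` or coordinate `i` reaches `1`.
  set a := min (f j) (1 - f i) with ha
  have ha0 : 0 < a := lt_min hj0 (by linarith)
  have haj : a ≤ f j := min_le_left _ _
  have hai : a ≤ 1 - f i := min_le_right _ _
  set g : Fin p → ℝ := f + a • (Pi.single i 1 - Pi.single j 1) with hg
  have gi : g i = f i + a := by simp [hg, hij]
  have gj : g j = f j - a := by simp [hg, hij.symm]; ring
  have gl : ∀ l, l ≠ i → l ≠ j → g l = f l := fun l h1 h2 => by simp [hg, h1, h2]
  refine ⟨a, ha0, g, rfl, fun l => ?_, ?_, ?_⟩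
  · by_cases h1 : l = i
    · subst h1; rw [gi]; constructor <;> linarith
    by_cases h2 : l = j
    · subst h2; rw [gj]; constructor <;> linarith
    rw [gl l h1 h2]; exact hf l
  · simp [hg, Finset.sum_add_distrib, Finset.sum_sub_distrib, ← Finset.mul_sum]
  · apply Set.ncard_lt_ncard _ (Set.toFinite _)
    refine (Set.ssubset_iff_of_subset fun l hl => ?_).2 ?_
    · by_cases h1 : l = i
      · subst h1; exact ⟨hi0, hi1⟩
      by_cases h2 : l = j
      · subst h2; exact ⟨hj0, hj1⟩
      simpa [gl l h1 h2] using hl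
    · rcases min_choice (f j) (1 - f i) with h | h
      · refine ⟨j, ⟨hj0, hj1⟩, fun hl => ?_⟩
        have := hl.1
        rw [gj, ha, h] at this; linarith
      · refine ⟨i, ⟨hi0, hi1⟩, fun hl => ?_⟩
        have := hl.2
        rw [gi, ha, h] at this; linarith

/-- A point of the unit cube is a convex combination of `0/1` vectors whose sums exceed
its own sum by at most `1`. -/
lemma mem_convexHull_zero_one {p : ℕ} (s : ℝ) (f : Fin p → ℝ) (hf : ∀ j, f j ∈ Set.Icc (0 : ℝ) 1)
    (hs : ∑ j, f j ≤ s) :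
    f ∈ convexHull ℝ {b : Fin p → ℝ | (∀ j, b j = 0 ∨ b j = 1) ∧ ∑ j, b j ≤ s + 1} := by
  induction hN : {l | f l ∈ Set.Ioo (0 : ℝ) 1}.ncard using Nat.strong_induction_on
    generalizing f with
  | _ N ih =>
  have hint : ∀ l, f l ∉ Set.Ioo (0 : ℝ) 1 → f l = 0 ∨ f l = 1 := by
    intro l hl
    rcases (hf l).1.eq_or_lt with h | h
    · exact Or.inl h.symm
    rcases (hf l).2.eq_or_lt with h' | h'
    · exact Or.inr h'
    · exact absurd ⟨h, h'⟩ hl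
  by_cases h0 : ∃ i, f i ∈ Set.Ioo (0 : ℝ) 1
  swap
  · push Not at h0
    exact subset_convexHull ℝ _ ⟨fun l => hint l (h0 l), by linarith⟩
  obtain ⟨i, hi⟩ := h0
  by_cases h1 : ∃ j, i ≠ j ∧ f j ∈ Set.Ioo (0 : ℝ) 1
  · obtain ⟨j, hij, hj⟩ := h1
    obtain ⟨a, ha, g, hg, hg1, hg2, hg3⟩ := exists_shift_card_fractional_lt hf hij hi hj
    obtain ⟨b, hb, g', hg', hg1', hg2', hg3'⟩ := exists_shift_card_fractional_lt hf hij.symm hj hi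
    have H := ih _ (hN ▸ hg3) g hg1 (hg2.trans_le hs) rfl
    have H' := ih _ (hN ▸ hg3') g' hg1' (hg2'.trans_le hs) rfl
    have hab : 0 < a + b := by linarith
    -- The shifts are opposite, of lengths `a` and `b`, so these weights cancel them.
    convert (convex_convexHull ℝ _) H H' (a := b / (a + b)) (b := a / (a + b))
      (by positivity) (by positivity) (by field_simp; ring) using 1
    funext l
    simp only [hg, hg', Pi.add_apply, Pi.smul_apply, Pi.sub_apply, smul_eq_mul]
    field_simp
    ring
  · push Not at h1
    -- With a single fractional coordinate left no mass can be exchanged; rounding it up costs the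
    -- extra `1`.
    have hup : ∀ v : ℝ, (v = 0 ∨ v = 1) → Function.update f i v ∈
        {b : Fin p → ℝ | (∀ j, b j = 0 ∨ b j = 1) ∧ ∑ j, b j ≤ s + 1} := by
      intro v hv
      refine ⟨fun j => ?_, ?_⟩
      · by_cases h : j = i
        · subst h; simpa using hv
        · simpa [h] using hint j (h1 j (Ne.symm h))
      · have e1 := Finset.add_sum_erase Finset.univ f (Finset.mem_univ i)
        rw [Finset.sum_update_of_mem (Finset.mem_univ i), ← Finset.erase_eq]
        have := hi.1
        rcases hv with rfl | rfl <;> linarith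
    convert (convex_convexHull ℝ _) (subset_convexHull ℝ _ (hup 0 (Or.inl rfl)))
      (subset_convexHull ℝ _ (hup 1 (Or.inr rfl))) (a := 1 - f i) (b := f i)
      (by linarith [hi.2]) hi.1.le (by ring) using 1
    funext l
    by_cases h : l = i
    · subst h; simp
    · simp [h]; ring

/-- The integer vectors with `ℓ¹` norm at most `2m` and squared `ℓ²` norm at most `5m`. -/
def roundingSet (p m : ℕ) : Set (Fin p → ℝ) :=
  {z | (∃ w : Fin p → ℤ, z = fun j => (w j : ℝ)) ∧ ∑ j, |z j| ≤ 2 * m ∧ ∑ j, z j ^ 2 ≤ 5 * m}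

/-- Keep the signs and the floors of `|y j|`, and round only the fractional parts. The excess `1` in
the `ℓ¹` norm is absorbed by `1 ≤ m`; a rounded value `a` satisfies `a² ≤ y² + 2|a|`, whence `m + 2
· 2m = 5m`. -/
lemma mem_convexHull_roundingSet {p m : ℕ} (hm : 1 ≤ m) (y : Fin p → ℝ)
    (h1 : ∑ j, |y j| ≤ m) (h2 : ∑ j, y j ^ 2 ≤ m) : y ∈ convexHull ℝ (roundingSet p m) := by
  have hm' : (1 : ℝ) ≤ m := by exact_mod_cast hm
  let σ : Fin p → ℤ := fun j => if y j < 0 then -1 else 1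
  have hσ : ∀ j, |(σ j : ℝ)| = 1 := fun j => by
    simp only [σ]; split_ifs <;> simp
  have hσy : ∀ j, (σ j : ℝ) * |y j| = y j := fun j => by
    simp only [σ]; split_ifs with h
    · simp [abs_of_neg h]
    · simp [abs_of_nonneg (not_lt.1 h)]
  let A : (Fin p → ℝ) → Fin p → ℝ := fun b j => σ j * (⌊|y j|⌋ + b j)
  have hconv : Convex ℝ (A ⁻¹' convexHull ℝ (roundingSet p m)) := by
    intro b hb b' hb' s t hs ht hst
    have e : A (s • b + t • b') = s • A b + t • A b' := by
      funext j
      simp only [A, Pi.add_apply, Pi.smul_apply, smul_eq_mul]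
      linear_combination (-(σ j : ℝ) * ⌊|y j|⌋) * hst
    simp only [Set.mem_preimage] at hb hb' ⊢
    rw [e]
    exact convex_convexHull ℝ _ hb hb' hs ht hst
  have hvert : {b : Fin p → ℝ | (∀ j, b j = 0 ∨ b j = 1) ∧
      ∑ j, b j ≤ ∑ j, Int.fract |y j| + 1} ⊆ A ⁻¹' convexHull ℝ (roundingSet p m) := by
    rintro b ⟨hb, hbs⟩
    refine subset_convexHull ℝ _ ?_
    have hb0 : ∀ j, 0 ≤ b j := fun j => by rcases hb j with h | h <;> simp [h]
    have hb1 : ∀ j, b j ≤ 1 := fun j => by rcases hb j with h | h <;> simp [h]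
    have hfl : ∀ j, (0 : ℝ) ≤ ⌊|y j|⌋ := fun j => by
      exact_mod_cast Int.floor_nonneg.2 (abs_nonneg (y j))
    have habs : ∀ j, |A b j| = ⌊|y j|⌋ + b j := fun j => by
      simp only [A]
      rw [abs_mul, hσ, one_mul, abs_of_nonneg (add_nonneg (hfl j) (hb0 j))]
    have hsum : ∑ j, |A b j| ≤ 2 * m := by
      simp only [habs]
      have : ∑ j, |y j| = ∑ j, (⌊|y j|⌋ : ℝ) + ∑ j, Int.fract |y j| := by
        rw [← Finset.sum_add_distrib]
        exact Finset.sum_congr rfl fun j _ => (Int.floor_add_fract _).symm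
      rw [Finset.sum_add_distrib]
      linarith
    refine ⟨?_, hsum, ?_⟩
    · have : ∀ j, ∃ c : ℤ, A b j = c := fun j => by
        rcases hb j with h | h
        · exact ⟨σ j * ⌊|y j|⌋, by simp [A, h]⟩
        · exact ⟨σ j * (⌊|y j|⌋ + 1), by simp [A, h]⟩
      choose c hc using this
      exact ⟨c, funext hc⟩
    · have hq : ∀ j, A b j ^ 2 ≤ y j ^ 2 + 2 * |A b j| := fun j => by
        rw [← sq_abs (A b j), ← sq_abs (y j), habs]
        have h3 := Int.floor_le |y j|
        have h4 := hfl j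
        rcases hb j with h | h <;> rw [h] <;> nlinarith
      calc ∑ j, A b j ^ 2 ≤ ∑ j, (y j ^ 2 + 2 * |A b j|) := Finset.sum_le_sum fun j _ => hq j
        _ = ∑ j, y j ^ 2 + 2 * ∑ j, |A b j| := by rw [Finset.sum_add_distrib, Finset.mul_sum]
        _ ≤ 5 * m := by linarith
  have hmem := convexHull_min hvert hconv (mem_convexHull_zero_one _ (fun j => Int.fract |y j|)
    (fun j => ⟨Int.fract_nonneg _, (Int.fract_lt_one _).le⟩) le_rfl)
  have hA : A (fun j => Int.fract |y j|) = y := by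
    funext j
    simp only [A, Int.floor_add_fract, hσy]
  rwa [Set.mem_preimage, hA] at hmem

/-! ### Polarization -/

/-- A symmetric bilinear form bounded on sparse integer vectors is bounded on the whole
`ℓ¹`-`ℓ²` ball. -/
lemma abs_bilin_le_of_int {p m : ℕ} (hm : 1 ≤ m) (B : LinearMap.BilinForm ℝ (Fin p → ℝ))
    (hB : ∀ u v, B u v = B v u) {ε : ℝ} (hε : 0 ≤ ε)
    (h : ∀ w : Fin p → ℤ, ∑ j, |w j| ≤ (4 * m : ℕ) →
      |B (fun j => (w j : ℝ)) (fun j => (w j : ℝ))| ≤ ε * ∑ j, (w j : ℝ) ^ 2)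
    (y : Fin p → ℝ) (h1 : ∑ j, |y j| ≤ m) (h2 : ∑ j, y j ^ 2 ≤ m) :
    |B y y| ≤ 5 * ε * m := by
  have hT : ∀ u ∈ roundingSet p m, ∀ v ∈ roundingSet p m, |B u v| ≤ 5 * ε * m := by
    rintro u ⟨⟨a, rfl⟩, hu1, hu2⟩ v ⟨⟨b, rfl⟩, hv1, hv2⟩
    set u : Fin p → ℝ := fun j => (a j : ℝ)
    set v : Fin p → ℝ := fun j => (b j : ℝ)
    have hl1 : ∀ c : Fin p → ℤ, (∀ j, |c j| ≤ |a j| + |b j|) → ∑ j, |c j| ≤ (4 * m : ℕ) := by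
      intro c hc
      have : ∑ j, |(c j : ℝ)| ≤ ((4 * m : ℕ) : ℝ) := by
        calc ∑ j, |(c j : ℝ)| ≤ ∑ j, (|(a j : ℝ)| + |(b j : ℝ)|) :=
              Finset.sum_le_sum fun j _ => by exact_mod_cast hc j
          _ ≤ ((4 * m : ℕ) : ℝ) := by rw [Finset.sum_add_distrib]; push_cast; linarith
      exact_mod_cast this
    have hp := h (a + b) (hl1 _ fun j => abs_add_le _ _)
    have hn := h (a - b) (hl1 _ fun j => abs_sub _ _)
    have ep : (fun j => ((a + b) j : ℝ)) = u + v := by funext j; simp [u, v]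
    have en : (fun j => ((a - b) j : ℝ)) = u - v := by funext j; simp [u, v]
    have es : ∑ j, ((a + b) j : ℝ) ^ 2 + ∑ j, ((a - b) j : ℝ) ^ 2
        = 2 * ∑ j, u j ^ 2 + 2 * ∑ j, v j ^ 2 := by
      rw [Finset.mul_sum, Finset.mul_sum, ← Finset.sum_add_distrib, ← Finset.sum_add_distrib]
      refine Finset.sum_congr rfl fun j _ => ?_
      simp only [u, v, Pi.add_apply, Pi.sub_apply]
      push_cast; ring
    rw [ep] at hp
    rw [en] at hn
    have hpol : 4 * B u v = B (u + v) (u + v) - B (u - v) (u - v) := by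
      simp only [map_add, map_sub, LinearMap.add_apply, LinearMap.sub_apply, hB v u]
      ring
    have h5 : ε * (∑ j, ((a + b) j : ℝ) ^ 2 + ∑ j, ((a - b) j : ℝ) ^ 2) ≤ ε * (20 * m) := by
      rw [es]
      exact mul_le_mul_of_nonneg_left (by linarith) hε
    rw [abs_le] at hp hn ⊢
    constructor <;> nlinarith [hp.1, hp.2, hn.1, hn.2]
  have hcl : ∀ u, Convex ℝ {v | |B u v| ≤ 5 * ε * m} := by
    intro u
    have : {v | |B u v| ≤ 5 * ε * m} = B u ⁻¹' Set.Icc (-(5 * ε * m)) (5 * ε * m) := by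
      ext v; simp [abs_le]
    rw [this]
    exact (convex_Icc _ _).linear_preimage (B u)
  have hy := mem_convexHull_roundingSet hm y h1 h2
  -- The quadratic form need not be convex, so the arguments are extended to the hull one at a time.
  have hhalf : ∀ u ∈ roundingSet p m, |B u y| ≤ 5 * ε * m := fun u hu =>
    convexHull_min (fun v hv => hT u hu v hv) (hcl u) hy
  exact convexHull_min (fun u hu => by simpa [hB y u] using hhalf u hu) (hcl y) hy

/-! ### Chi-square concentration -/

/-- This is `-log (1 - s) ≤ s + s²`, used at `s = 2t` to bound the chi-square factor `(1 -
2t)^(-1/2)`. -/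
lemma one_le_one_sub_mul_exp {s : ℝ} (h : |s| ≤ 1 / 2) : 1 ≤ (1 - s) * Real.exp (s + s ^ 2) := by
  obtain ⟨h1, h2⟩ := abs_le.1 h
  rcases le_total s 0 with hs | hs
  · have := Real.add_one_le_exp (s + s ^ 2)
    calc (1 : ℝ) ≤ (1 - s) * (s + s ^ 2 + 1) := by
          nlinarith [mul_nonneg (neg_nonneg.2 hs) (sq_nonneg s)]
      _ ≤ _ := by gcongr; linarith
  · have := Real.quadratic_le_exp_of_nonneg (x := s + s ^ 2) (by positivity)
    have h3 : 2 * s ≤ (1 - s) * (1 + s) ^ 2 := by nlinarith [mul_nonneg hs (sub_nonneg.2 h2)]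
    calc (1 : ℝ) ≤ (1 - s) * (1 + (s + s ^ 2) + (s + s ^ 2) ^ 2 / 2) := by
          nlinarith [mul_le_mul_of_nonneg_left h3 (sq_nonneg s)]
      _ ≤ _ := by gcongr; linarith

lemma gaussianPDFReal_mul_exp_sq (t x : ℝ) :
    gaussianPDFReal 0 1 x • Real.exp (t * (x ^ 2 - 1))
      = ((√(2 * Real.pi))⁻¹ * Real.exp (-t)) * Real.exp (-(1 / 2 - t) * x ^ 2) := by
  simp only [gaussianPDFReal_def, smul_eq_mul, NNReal.coe_one, mul_one, sub_zero]
  rw [mul_assoc, mul_assoc, ← Real.exp_add, ← Real.exp_add]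
  congr 2
  ring

lemma integrable_exp_mul_sq_sub_one_gaussianReal {t : ℝ} (ht : t < 1 / 2) :
    Integrable (fun x => Real.exp (t * (x ^ 2 - 1))) (gaussianReal 0 1) := by
  rw [gaussianReal_of_var_ne_zero _ one_ne_zero,
    integrable_withDensity_iff_integrable_smul' (measurable_gaussianPDF 0 1)
      (ae_of_all _ fun _ => gaussianPDF_lt_top)]
  simp only [toReal_gaussianPDF, gaussianPDFReal_mul_exp_sq]
  exact (integrable_exp_neg_mul_sq (by linarith)).const_mul _

lemma mgf_sq_sub_one_gaussianReal_le {t : ℝ} (ht : |t| ≤ 1 / 4) :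
    mgf (fun x => x ^ 2 - 1) (gaussianReal 0 1) t ≤ Real.exp (2 * t ^ 2) := by
  have ht' := abs_le.1 ht
  rw [mgf, integral_gaussianReal_eq_integral_smul one_ne_zero]
  simp only [gaussianPDFReal_mul_exp_sq]
  rw [integral_const_mul, integral_gaussian]
  have hpos : 0 < 1 - 2 * t := by linarith
  have hkey := one_le_one_sub_mul_exp (s := 2 * t) (by rw [abs_mul, abs_two]; linarith)
  have e : (√(2 * Real.pi))⁻¹ * √(Real.pi / (1 / 2 - t)) = √((1 - 2 * t)⁻¹) := by
    rw [← Real.sqrt_inv, ← Real.sqrt_mul (by positivity)]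
    congr 1
    have := Real.pi_ne_zero
    have h2 : (1 / 2 - t) ≠ 0 := by linarith
    field_simp
  have hle : √((1 - 2 * t)⁻¹) ≤ Real.exp (t + 2 * t ^ 2) := by
    rw [Real.sqrt_le_left (Real.exp_pos _).le, ← Real.exp_nat_mul, inv_le_iff_one_le_mul₀ hpos]
    rw [mul_comm]
    refine hkey.trans_eq ?_
    congr 2
    push_cast; ring
  calc _ = √((1 - 2 * t)⁻¹) * Real.exp (-t) := by rw [← e]; ring
    _ ≤ Real.exp (t + 2 * t ^ 2) * Real.exp (-t) := by gcongr
    _ = _ := by rw [← Real.exp_add]; congr 1; ring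

/-- Concentration of a sum of squares of independent standard Gaussian variables. -/
lemma measureReal_abs_sum_sq_sub_card_ge_le {Ω : Type*} [MeasurableSpace Ω] {μ : Measure Ω}
    [IsProbabilityMeasure μ] {n : ℕ} {Y : Fin n → Ω → ℝ} (hY : iIndepFun Y μ)
    (hlaw : ∀ i, HasLaw (Y i) (gaussianReal 0 1) μ) {ε : ℝ} (h0 : 0 ≤ ε) (h1 : ε ≤ 1) :
    μ.real {ω | ε * n ≤ |∑ i, Y i ω ^ 2 - n|} ≤ 2 * Real.exp (-(ε ^ 2 * n / 8)) := by
  let Z : Fin n → Ω → ℝ := fun i ω => Y i ω ^ 2 - 1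
  have hZm : ∀ i, AEMeasurable (Z i) μ := fun i => ((hlaw i).aemeasurable.pow_const 2).sub_const 1
  have hZ : iIndepFun Z μ := hY.comp (fun _ x => x ^ 2 - 1) fun _ => by fun_prop
  have hint : ∀ i, ∀ t : ℝ, t < 1 / 2 → Integrable (fun ω => Real.exp (t * Z i ω)) μ := by
    intro i t ht
    have := integrable_exp_mul_sq_sub_one_gaussianReal ht
    rw [← (hlaw i).map_eq] at this
    exact this.comp_aemeasurable (hlaw i).aemeasurable
  have hmgf : ∀ i, ∀ t : ℝ, |t| ≤ 1 / 4 → mgf (Z i) μ t ≤ Real.exp (2 * t ^ 2) := by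
    intro i t ht
    refine le_trans (le_of_eq ?_) (mgf_sq_sub_one_gaussianReal_le ht)
    rw [← (hlaw i).map_eq, mgf, mgf,
      integral_map (hlaw i).aemeasurable (by fun_prop)]
  have hsmgf : ∀ t : ℝ, |t| ≤ 1 / 4 →
      mgf (∑ i, Z i) μ t ≤ Real.exp (2 * t ^ 2 * n) := by
    intro t ht
    rw [hZ.mgf_sum₀ hZm]
    calc ∏ i, mgf (Z i) μ t ≤ ∏ _i : Fin n, Real.exp (2 * t ^ 2) :=
          Finset.prod_le_prod (fun i _ => mgf_nonneg) fun i _ => hmgf i t ht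
      _ = _ := by rw [Finset.prod_const, Finset.card_univ, Fintype.card_fin, ← Real.exp_nat_mul,
                    mul_comm]
  have hsint : ∀ t : ℝ, t < 1 / 2 → Integrable (fun ω => Real.exp (t * (∑ i, Z i) ω)) μ := by
    intro t ht
    -- The mgf takes the default value `0` when the exponential is not integrable, so positivity
    -- yields integrability.
    rw [← mgf_pos_iff, hZ.mgf_sum₀ hZm]
    exact Finset.prod_pos fun i _ => mgf_pos (hint i t ht)
  have hsum : ∀ ω, (∑ i, Z i) ω = ∑ i, Y i ω ^ 2 - n := fun ω => by
    simp [Z, Finset.sum_apply, Finset.sum_sub_distrib]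
  have hup : μ.real {ω | ε * n ≤ (∑ i, Z i) ω} ≤ Real.exp (-(ε ^ 2 * n / 8)) := by
    -- `t = ε / 4` minimizes `2t²n - tεn`, and `ε ≤ 1` keeps it in the range of the mgf bound.
    refine (measure_ge_le_exp_mul_mgf (t := ε / 4) (ε * n) (by positivity)
      (hsint _ (by linarith))).trans ?_
    refine (mul_le_mul_of_nonneg_left (hsmgf (ε / 4)
      (by rw [abs_of_nonneg (by positivity)]; linarith)) (Real.exp_pos _).le).trans_eq ?_
    rw [← Real.exp_add]; congr 1; ring
  have hlo : μ.real {ω | (∑ i, Z i) ω ≤ -(ε * n)} ≤ Real.exp (-(ε ^ 2 * n / 8)) := by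
    refine (measure_le_le_exp_mul_mgf (t := -(ε / 4)) (-(ε * n)) (by linarith)
      (hsint _ (by linarith))).trans ?_
    refine (mul_le_mul_of_nonneg_left (hsmgf (-(ε / 4))
      (by rw [abs_neg, abs_of_nonneg (by positivity)]; linarith)) (Real.exp_pos _).le).trans_eq ?_
    rw [← Real.exp_add]; congr 1; ring
  calc μ.real {ω | ε * n ≤ |∑ i, Y i ω ^ 2 - n|}
      ≤ μ.real ({ω | ε * n ≤ (∑ i, Z i) ω} ∪ {ω | (∑ i, Z i) ω ≤ -(ε * n)}) := by
        refine measureReal_mono fun ω hω => ?_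
        simp only [Set.mem_ofPred_eq, Set.mem_union, hsum] at hω ⊢
        rcases le_abs.1 hω with h | h
        · exact Or.inl h
        · right; linarith
    _ ≤ _ := (measureReal_union_le _ _).trans (by linarith)

/-! ### A Gaussian matrix applied to a fixed vector -/

section Gaussian

variable {Ω : Type*} [MeasurableSpace Ω] {μ : Measure Ω} {n p : ℕ}
  {X : Ω → Matrix (Fin n) (Fin p) ℝ}

lemma HasIIDStdGaussianEntries.hasGaussianLaw_mulVec (hX : HasIIDStdGaussianEntries X μ)
    (w : Fin p → ℝ) : HasGaussianLaw (fun ω i => (X ω *ᵥ w) i) μ := by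
  have h1 : HasGaussianLaw (fun ω (ij : Fin n × Fin p) => X ω ij.1 ij.2) μ :=
    iIndepFun.hasGaussianLaw (fun ij => (hX.hasLaw ij.1 ij.2).hasGaussianLaw) hX.indep
  let L : (Fin n × Fin p → ℝ) →ₗ[ℝ] (Fin n → ℝ) :=
    LinearMap.pi fun i => ∑ j, w j • LinearMap.proj (i, j)
  have h2 := h1.map_fun L.toContinuousLinearMap
  have e : (fun ω => L.toContinuousLinearMap fun ij : Fin n × Fin p => X ω ij.1 ij.2)
      = fun ω i => (X ω *ᵥ w) i := by
    funext ω i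
    simp [L, Matrix.mulVec, dotProduct, mul_comm]
  rwa [e] at h2

lemma HasIIDStdGaussianEntries.memLp_two (hX : HasIIDStdGaussianEntries X μ) (i : Fin n)
    (j : Fin p) : MemLp (fun ω => X ω i j) 2 μ :=
  (hX.hasLaw i j).hasGaussianLaw.memLp_two

lemma HasIIDStdGaussianEntries.covariance_mulVec (hX : HasIIDStdGaussianEntries X μ)
    [IsProbabilityMeasure μ] (w : Fin p → ℝ) (i i' : Fin n) :
    cov[fun ω => (X ω *ᵥ w) i, fun ω => (X ω *ᵥ w) i'; μ]
      = if i = i' then ∑ j, w j ^ 2 else 0 := by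
  have hvar : ∀ i j, Var[fun ω => X ω i j; μ] = 1 := fun i j => by
    rw [(hX.hasLaw i j).variance_eq, variance_id_gaussianReal]; simp
  have hcov : ∀ i j i' j', cov[fun ω => X ω i j, fun ω => X ω i' j'; μ]
      = if i = i' ∧ j = j' then 1 else 0 := by
    intro i j i' j'
    split_ifs with h
    · obtain ⟨rfl, rfl⟩ := h
      rw [covariance_self (hX.hasLaw i j).aemeasurable, hvar]
    · exact (hX.indep.indepFun (i := (i, j)) (j := (i', j')) (by simpa using h)).covariance_eq_zero
        (hX.memLp_two i j) (hX.memLp_two i' j')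
  simp only [Matrix.mulVec, dotProduct]
  rw [covariance_fun_sum_fun_sum (fun j => (hX.memLp_two i j).mul_const _)
    (fun j => (hX.memLp_two i' j).mul_const _)]
  simp only [covariance_mul_const_left, covariance_mul_const_right, hcov]
  by_cases h : i = i'
  · simp [h, sq]
  · simp [h]

lemma HasIIDStdGaussianEntries.iIndepFun_mulVec (hX : HasIIDStdGaussianEntries X μ)
    [IsProbabilityMeasure μ] (w : Fin p → ℝ) : iIndepFun (fun i ω => (X ω *ᵥ w) i) μ :=
  (hX.hasGaussianLaw_mulVec w).iIndepFun_of_covariance_eq_zero fun i i' h => by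
    rw [hX.covariance_mulVec, if_neg h]

lemma HasIIDStdGaussianEntries.hasLaw_mulVec (hX : HasIIDStdGaussianEntries X μ)
    [IsProbabilityMeasure μ] {w : Fin p → ℝ} (hw : ∑ j, w j ^ 2 = 1) (i : Fin n) :
    HasLaw (fun ω => (X ω *ᵥ w) i) (gaussianReal 0 1) μ := by
  have hg := (hX.hasGaussianLaw_mulVec w).eval i
  refine ⟨hg.aemeasurable, ?_⟩
  rw [hg.map_eq_gaussianReal, ← covariance_self hg.aemeasurable, hX.covariance_mulVec, if_pos rfl,
    hw, Real.toNNReal_one]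
  congr 1
  simp only [Matrix.mulVec, dotProduct]
  rw [integral_finsetSum _ fun j _ => ((hX.memLp_two i j).integrable (by norm_num)).mul_const _]
  refine Finset.sum_eq_zero fun j _ => ?_
  rw [integral_mul_const, (hX.hasLaw i j).integral_eq, integral_id_gaussianReal, zero_mul]

lemma HasIIDStdGaussianEntries.measureReal_abs_sum_mulVec_sq_gt_le
    (hX : HasIIDStdGaussianEntries X μ) [IsProbabilityMeasure μ] (w : Fin p → ℝ) {ε : ℝ}
    (h0 : 0 ≤ ε) (h1 : ε ≤ 1) :
    μ.real {ω | ε * n * ∑ j, w j ^ 2 < |∑ i, (X ω *ᵥ w) i ^ 2 - n * ∑ j, w j ^ 2|}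
      ≤ 2 * Real.exp (-(ε ^ 2 * n / 8)) := by
  set S := ∑ j, w j ^ 2 with hS
  have hS0 : 0 ≤ S := Finset.sum_nonneg fun j _ => sq_nonneg (w j)
  rcases hS0.eq_or_lt with hz | hpos
  -- Here the strict inequality makes the bad event empty.
  · have hw : w = 0 := by
      rw [eq_comm, hS, Finset.sum_eq_zero_iff_of_nonneg fun j _ => sq_nonneg _] at hz
      funext j
      simpa using hz j (Finset.mem_univ j)
    rw [← hz]
    simp only [hw, Matrix.mulVec_zero, Pi.zero_apply]
    simp
    positivity
  have hsq : (√S) ^ 2 = S := Real.sq_sqrt hpos.le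
  let v : Fin p → ℝ := (√S)⁻¹ • w
  have hv : ∑ j, v j ^ 2 = 1 := by
    simp only [v, Pi.smul_apply, smul_eq_mul, mul_pow, inv_pow, hsq]
    rw [← Finset.mul_sum, ← hS, inv_mul_cancel₀ hpos.ne']
  refine le_trans (measureReal_mono fun ω hω => ?_) (measureReal_abs_sum_sq_sub_card_ge_le
    (hX.iIndepFun_mulVec v) (hX.hasLaw_mulVec hv) h0 h1)
  simp only [Set.mem_ofPred_eq] at hω ⊢
  have e : ∑ i, (X ω *ᵥ v) i ^ 2 - n = S⁻¹ * (∑ i, (X ω *ᵥ w) i ^ 2 - n * S) := by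
    simp only [v, Matrix.mulVec_smul, Pi.smul_apply, smul_eq_mul, mul_pow, inv_pow, hsq]
    rw [← Finset.mul_sum, mul_sub, mul_left_comm, inv_mul_cancel₀ hpos.ne', mul_one]
  rw [e, abs_mul, abs_of_pos (inv_pos.2 hpos), inv_mul_eq_div, le_div_iff₀ hpos]
  exact hω.le

end Gaussian

/-! ### Deterministic consequences of control on integer vectors -/

lemma sum_mulVec_sq_ge_of_int {n p m : ℕ} (hm : 1 ≤ m) (X : Matrix (Fin n) (Fin p) ℝ) {ε : ℝ}
    (hε : 0 ≤ ε)
    (h : ∀ w : Fin p → ℤ, ∑ j, |w j| ≤ (4 * m : ℕ) →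
      |∑ i, (X *ᵥ fun j => (w j : ℝ)) i ^ 2 - n * ∑ j, (w j : ℝ) ^ 2|
        ≤ ε * n * ∑ j, (w j : ℝ) ^ 2)
    (d : Fin p → ℝ) (hd : (∑ j, |d j|) ^ 2 ≤ m * ∑ j, d j ^ 2) :
    (1 - 5 * ε) * n * ∑ j, d j ^ 2 ≤ ∑ i, (X *ᵥ d) i ^ 2 := by
  set S := ∑ j, d j ^ 2 with hS
  have hS0 : 0 ≤ S := Finset.sum_nonneg fun j _ => sq_nonneg (d j)
  rcases hS0.eq_or_lt with hz | hpos
  · rw [← hz, mul_zero]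
    exact Finset.sum_nonneg fun i _ => sq_nonneg _
  have hm' : (1 : ℝ) ≤ m := by exact_mod_cast hm
  let B : LinearMap.BilinForm ℝ (Fin p → ℝ) :=
    Matrix.toBilin' (Xᵀ * X - (n : ℝ) • (1 : Matrix (Fin p) (Fin p) ℝ))
  have hBuv : ∀ u v, B u v = (X *ᵥ u) ⬝ᵥ (X *ᵥ v) - n * (u ⬝ᵥ v) := by
    intro u v
    simp only [B, Matrix.toBilin'_apply', Matrix.sub_mulVec, Matrix.smul_mulVec, Matrix.one_mulVec,
      dotProduct_sub, dotProduct_smul, smul_eq_mul]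
    rw [← Matrix.mulVec_mulVec, Matrix.dotProduct_mulVec, Matrix.vecMul_transpose]
  have hBw : ∀ u, B u u = ∑ i, (X *ᵥ u) i ^ 2 - n * ∑ j, u j ^ 2 := fun u => by
    simp only [hBuv, dotProduct, sq]
  -- Scales `d` to squared norm `m`; `hd` then bounds its `ℓ¹` norm by `m`.
  let c : ℝ := √(m / S)
  have hc : c ^ 2 = m / S := Real.sq_sqrt (by positivity)
  have hc0 : 0 ≤ c := Real.sqrt_nonneg _
  have key := abs_bilin_le_of_int hm B
    (fun u v => by rw [hBuv, hBuv, dotProduct_comm u, dotProduct_comm (X *ᵥ u)])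
    (ε := ε * n) (by positivity) (fun w hw => by rw [hBw]; exact h w hw) (c • d) ?_ ?_
  · have h1 := (abs_le.1 key).1
    simp only [map_smul, LinearMap.smul_apply, smul_eq_mul, hBw] at h1
    rw [← mul_assoc c c, ← sq c, hc, ← hS, div_mul_eq_mul_div, le_div_iff₀ hpos] at h1
    have h2 : 0 ≤ (m : ℝ) * (∑ i, (X *ᵥ d) i ^ 2 - (1 - 5 * ε) * n * S) := by linarith
    have h3 := nonneg_of_mul_nonneg_right h2 (by linarith)
    linarith
  · simp only [Pi.smul_apply, smul_eq_mul, abs_mul, abs_of_nonneg hc0, ← Finset.mul_sum]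
    refine abs_le_of_sq_le_sq' ?_ (by positivity) |>.2
    rw [mul_pow, hc, div_mul_eq_mul_div, div_le_iff₀ hpos]
    nlinarith
  · simp only [Pi.smul_apply, smul_eq_mul, mul_pow, ← Finset.mul_sum, hc, ← hS]
    rw [div_mul_cancel₀ _ hpos.ne']

lemma columnNorm_sq {n p : ℕ} (X : Matrix (Fin n) (Fin p) ℝ) (j : Fin p) :
    columnNorm X j ^ 2 = ∑ i, X i j ^ 2 := by
  simp [columnNorm, EuclideanSpace.real_norm_sq_eq]

lemma columnNorm_le_of_int {n p m : ℕ} (hm : 1 ≤ m) (X : Matrix (Fin n) (Fin p) ℝ) {ε δ : ℝ}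
    (hδ : 0 ≤ δ) (hεδ : ε ≤ δ)
    (h : ∀ w : Fin p → ℤ, ∑ j, |w j| ≤ (4 * m : ℕ) →
      |∑ i, (X *ᵥ fun j => (w j : ℝ)) i ^ 2 - n * ∑ j, (w j : ℝ) ^ 2|
        ≤ ε * n * ∑ j, (w j : ℝ) ^ 2) (j : Fin p) :
    columnNorm X j ≤ (1 + δ) * √(n : ℝ) := by
  have hj := h (Pi.single j 1) (by
    rw [Finset.sum_eq_single j (fun i _ hi => by simp [hi]) (by simp)]
    simp; omega)
  have e : (fun l => ((Pi.single j 1 : Fin p → ℤ) l : ℝ)) = Pi.single j 1 := by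
    funext l
    by_cases hl : l = j
    · subst hl; simp
    · simp [hl]
  have e2 : ∑ l, ((Pi.single j 1 : Fin p → ℤ) l : ℝ) ^ 2 = 1 := by
    rw [Finset.sum_eq_single j (fun i _ hi => by simp [hi]) (by simp)]
    simp
  rw [e, e2, Matrix.mulVec_single_one] at hj
  have h2 := (abs_le.1 hj).2
  simp only [Matrix.col_apply] at h2
  have hn : (0 : ℝ) ≤ n := Nat.cast_nonneg n
  refine abs_le_of_sq_le_sq' ?_ (by positivity) |>.2
  rw [columnNorm_sq, mul_pow, Real.sq_sqrt hn]
  nlinarith [mul_le_mul_of_nonneg_right hεδ hn, mul_nonneg (sq_nonneg δ) hn]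

lemma one_sub_le_sreConst_of_int {n p k m : ℕ} (hn : 0 < n) (hp : 1 ≤ p) (hk : 1 ≤ k) (hm : 1 ≤ m)
    {c₀ δ : ℝ} (hc : 0 ≤ c₀) (hm' : (1 + c₀) ^ 2 * k ≤ m) (hδ : 0 ≤ δ) (hδ1 : δ ≤ 1)
    (X : Matrix (Fin n) (Fin p) ℝ)
    (h : ∀ w : Fin p → ℤ, ∑ j, |w j| ≤ (4 * m : ℕ) →
      |∑ i, (X *ᵥ fun j => (w j : ℝ)) i ^ 2 - n * ∑ j, (w j : ℝ) ^ 2|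
        ≤ δ / 5 * n * ∑ j, (w j : ℝ) ^ 2) :
    1 - δ ≤ sreConst X k c₀ := by
  have hn' : (0 : ℝ) < n := by exact_mod_cast hn
  -- A real `sInf` over the empty set is `0`, so a nonzero cone vector is needed: a basis vector.
  refine le_csInf (Set.Nonempty.image _ ?_) ?_
  · refine ⟨EuclideanSpace.single ⟨0, hp⟩ 1, ?_, by simp⟩
    have hk' : 1 ≤ √(k : ℝ) := Real.one_le_sqrt.2 (by exact_mod_cast hk)
    simp only [sreCone, Set.mem_ofPred_eq, PiLp.norm_single, norm_one, mul_one]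
    rw [Finset.sum_eq_single ⟨0, hp⟩ (fun i _ hi => by simp [hi]) (by simp)]
    simp only [PiLp.single_apply, if_true, abs_one]
    nlinarith
  · rintro _ ⟨d, ⟨hd, hd0⟩, rfl⟩
    have hdpos : 0 < ‖d‖ := norm_pos_iff.2 (by simpa using hd0)
    have hsq : ‖d‖ ^ 2 = ∑ j, d.ofLp j ^ 2 := EuclideanSpace.real_norm_sq_eq d
    have hcone : (∑ j, |d.ofLp j|) ^ 2 ≤ m * ∑ j, d.ofLp j ^ 2 := by
      have h1 : (∑ j, |d.ofLp j|) ^ 2 ≤ ((1 + c₀) * √(k : ℝ) * ‖d‖) ^ 2 :=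
        pow_le_pow_left₀ (Finset.sum_nonneg fun j _ => abs_nonneg _) hd 2
      rw [mul_pow, mul_pow, Real.sq_sqrt (Nat.cast_nonneg k), hsq] at h1
      exact h1.trans (mul_le_mul_of_nonneg_right hm' (Finset.sum_nonneg fun j _ => sq_nonneg _))
    have hkey := sum_mulVec_sq_ge_of_int hm X (by positivity) h d.ofLp hcone
    rw [← hsq] at hkey
    change 1 - δ ≤ ‖WithLp.toLp 2 (X *ᵥ d.ofLp)‖ / (√(n : ℝ) * ‖d‖)
    rw [le_div_iff₀ (mul_pos (Real.sqrt_pos.2 hn') hdpos)]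
    refine abs_le_of_sq_le_sq' ?_ (norm_nonneg _) |>.2
    rw [EuclideanSpace.real_norm_sq_eq, mul_pow, mul_pow, Real.sq_sqrt hn'.le]
    refine le_trans ?_ hkey
    have : 0 ≤ (n : ℝ) * ‖d‖ ^ 2 := by positivity
    -- Uses `(1 - δ)² ≤ 1 - δ`.
    nlinarith [mul_nonneg (mul_nonneg hδ (sub_nonneg.2 hδ1)) this]

/-! ### Union bound -/

/-- Since `2p + 1 ≤ p³`, the count costs `12 m log p`, and `12m + k ≤ 13 (2 + c₀)² k`. The deviation
exponent is `δ₀² n / 200`, whence `2600 = 13 · 200`. -/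
lemma card_bound_mul_exp_le {n p k m : ℕ} {c₀ δ₀ : ℝ} (hp : 2 ≤ p) (hk : 1 ≤ k) (hc : 0 < c₀)
    (hδ : 0 < δ₀) (hm : (m : ℝ) ≤ (1 + c₀) ^ 2 * k + 1)
    (hn : 2600 * (δ₀ ^ 2)⁻¹ * (2 + c₀) ^ 2 * k * Real.log p ≤ n) :
    ((2 * p + 1) ^ (4 * m) : ℕ) * (2 * Real.exp (-((δ₀ / 5) ^ 2 * n / 8)))
      ≤ 2 * Real.exp (-(1 * k * Real.log p)) := by
  have hp0 : (0 : ℝ) < p := by exact_mod_cast (by omega : 0 < p)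
  have hlog : 0 ≤ Real.log p := Real.log_natCast_nonneg p
  have hk' : (1 : ℝ) ≤ k := by exact_mod_cast hk
  have hcard : (((2 * p + 1) ^ (4 * m) : ℕ) : ℝ) ≤ Real.exp (12 * m * Real.log p) := by
    have h1 : 2 * p + 1 ≤ p ^ 3 := by nlinarith [Nat.mul_le_mul hp hp]
    have h2 : (2 * p + 1) ^ (4 * m) ≤ p ^ (12 * m) :=
      (Nat.pow_le_pow_left h1 _).trans_eq (by rw [← pow_mul]; congr 1; ring)
    calc (((2 * p + 1) ^ (4 * m) : ℕ) : ℝ) ≤ ((p ^ (12 * m) : ℕ) : ℝ) := by exact_mod_cast h2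
      _ = Real.exp (12 * m * Real.log p) := by
        rw [Nat.cast_pow, ← Real.exp_log (pow_pos hp0 _), Real.log_pow]
        push_cast; rfl
  have hn2 : 2600 * ((2 + c₀) ^ 2 * k * Real.log p) ≤ δ₀ ^ 2 * n := by
    calc 2600 * ((2 + c₀) ^ 2 * k * Real.log p)
        = δ₀ ^ 2 * (2600 * (δ₀ ^ 2)⁻¹ * (2 + c₀) ^ 2 * k * Real.log p) := by field_simp
      _ ≤ _ := by gcongr
  have hm2 : 12 * (m : ℝ) + k ≤ 13 * ((2 + c₀) ^ 2 * k) := by nlinarith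
  have hm3 := mul_le_mul_of_nonneg_right hm2 hlog
  calc _ ≤ Real.exp (12 * m * Real.log p) * (2 * Real.exp (-((δ₀ / 5) ^ 2 * n / 8))) := by gcongr
    _ = 2 * Real.exp (12 * m * Real.log p + -((δ₀ / 5) ^ 2 * n / 8)) := by rw [Real.exp_add]; ring
    _ ≤ _ := by gcongr; nlinarith

theorem lemma4p1 :
    ∃ C C' : ℝ, 0 < C ∧ 0 < C' ∧
      ∀ {Ω : Type*} [MeasurableSpace Ω] (μ : Measure Ω) [IsProbabilityMeasure μ]
        (n p k : ℕ) (c₀ δ₀ : ℝ) (X : Ω → Matrix (Fin n) (Fin p) ℝ),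
        2 ≤ p → 1 ≤ k → k ≤ p → 0 < c₀ → 0 < δ₀ → δ₀ < 1 →
        HasIIDStdGaussianEntries X μ →
        C * (δ₀ ^ 2)⁻¹ * (2 + c₀) ^ 2 * k * Real.log p ≤ n →
        1 - 2 * Real.exp (-(C' * k * Real.log p)) ≤
          μ.real {ω | (∀ j, columnNorm (X ω) j ≤ (1 + δ₀) * √(n : ℝ)) ∧
            1 - δ₀ ≤ sreConst (X ω) k c₀} := by
  refine ⟨2600, 1, by norm_num, one_pos, ?_⟩
  intro Ω _ μ _ n p k c₀ δ₀ X hp hk _ hc hδ hδ1 hX hn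
  have hk' : (1 : ℝ) ≤ k := by exact_mod_cast hk
  have hn0 : 0 < n := by
    have : 0 < Real.log p := Real.log_pos (by exact_mod_cast hp)
    have h1 : 0 < 2600 * (δ₀ ^ 2)⁻¹ * (2 + c₀) ^ 2 * k * Real.log p := by positivity
    exact_mod_cast h1.trans_le hn
  set m := ⌈(1 + c₀) ^ 2 * k⌉₊ with hm
  have hm_le : (1 + c₀) ^ 2 * k ≤ m := Nat.le_ceil _
  have hm_lt : (m : ℝ) ≤ (1 + c₀) ^ 2 * k + 1 := (Nat.ceil_lt_add_one (by positivity)).le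
  have hm1 : 1 ≤ m := Nat.one_le_ceil_iff.2 (by positivity)
  obtain ⟨W, hWcard, hW⟩ := exists_finset_int_l1_le p (4 * m)
  set E := {ω | (∀ j, columnNorm (X ω) j ≤ (1 + δ₀) * √(n : ℝ)) ∧
            1 - δ₀ ≤ sreConst (X ω) k c₀}
  let bad : (Fin p → ℤ) → Set Ω := fun w =>
    {ω | δ₀ / 5 * n * ∑ j, (w j : ℝ) ^ 2
      < |∑ i, (X ω *ᵥ fun j => (w j : ℝ)) i ^ 2 - n * ∑ j, (w j : ℝ) ^ 2|}
  have hcover : (Set.univ : Set Ω) ⊆ E ∪ ⋃ w ∈ W, bad w := by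
    intro ω _
    by_cases hω : ω ∈ ⋃ w ∈ W, bad w
    · exact Or.inr hω
    · left
      simp only [Set.mem_iUnion, not_exists] at hω
      have h : ∀ w : Fin p → ℤ, ∑ j, |w j| ≤ (4 * m : ℕ) →
          |∑ i, (X ω *ᵥ fun j => (w j : ℝ)) i ^ 2 - n * ∑ j, (w j : ℝ) ^ 2|
            ≤ δ₀ / 5 * n * ∑ j, (w j : ℝ) ^ 2 := fun w hw => not_lt.1 (hω w (hW w hw))
      exact ⟨fun j => columnNorm_le_of_int hm1 (X ω) hδ.le (by linarith) h j,
        one_sub_le_sreConst_of_int hn0 (by omega) hk hm1 hc.le hm_le hδ.le hδ1.le (X ω) h⟩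
  have hbad : μ.real (⋃ w ∈ W, bad w) ≤ 2 * Real.exp (-(1 * k * Real.log p)) := by
    calc μ.real (⋃ w ∈ W, bad w) ≤ ∑ w ∈ W, μ.real (bad w) := measureReal_biUnion_finset_le _ _
      _ ≤ ∑ _w ∈ W, 2 * Real.exp (-((δ₀ / 5) ^ 2 * n / 8)) :=
        Finset.sum_le_sum fun w _ =>
          hX.measureReal_abs_sum_mulVec_sq_gt_le _ (by positivity) (by linarith)
      _ = W.card * (2 * Real.exp (-((δ₀ / 5) ^ 2 * n / 8))) := by
        rw [Finset.sum_const, nsmul_eq_mul]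
      _ ≤ ((2 * p + 1) ^ (4 * m) : ℕ) * (2 * Real.exp (-((δ₀ / 5) ^ 2 * n / 8))) := by gcongr
      _ ≤ _ := card_bound_mul_exp_le hp hk hc hδ hm_lt hn
  -- Subadditivity over a cover of the whole space avoids any measurability of `E`.
  have htot : 1 ≤ μ.real E + μ.real (⋃ w ∈ W, bad w) := by
    calc (1 : ℝ) = μ.real Set.univ := probReal_univ.symm
      _ ≤ μ.real (E ∪ ⋃ w ∈ W, bad w) := measureReal_mono hcover
      _ ≤ _ := measureReal_union_le _ _
  linarith
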